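/- Let $E$ be a topological space with a $\sigma$-algebra $\mathcal B$ containing its open sets. Let $(P_t)_{t\ge 0}$ be the transition function of a time-homogeneous jump process on $E$: Markov kernels $P_t(x,A)$ with $P_0(x,\cdot)=\delta_x$, $P_{s+t}=P_sP_t$ and $\lim_{t\to0^+}P_t(x,A)=\mathbf 1_A(x)$ for all $x\in E$, $A\in\mathcal B$. Let $\pi$ be a stationary probability distribution, $\pi P_t=\pi$ for all $t\ge 0$. Assume that $P_t$ has a totally stable and conservative $q$-pair $(q(x),q(x,A))$, that is, a function $q:E\to[0,\infty)$ and a kernel $q(x,A)$ with $q(x,E)=q(x)$ and \[ \lim_{t\to0^+}\frac{P_t(x,A)-\mathbf 1_A(x)}{t}=q(x,A)-q(x)\mathbf 1_A(x),\qquad x\in E,\ A\in\mathcal B, \] and that the $q$-pair is uniformly bounded, $\sup_{x\in E}q(x)<\infty$. Let $\mathcal A$ be the infinitesimal generator of $P_t$ on $\mathcal L^2(\pi)$, that is, $f\in\mathcal D(\mathcal A)$ and $\mathcal Af=h$ if $f,h\in\mathcal L^2(\pi)$ and $(P_tf-f)/t\to h$ in $\mathcal L^2(\pi)$ as $t\to0^+$,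 and let \[ \lambda(q):=\inf\left\{-\langle\mathcal Af,f\rangle_\pi:\ f\in\mathcal D(\mathcal A),\ \|f\|_{\pi,2}=1,\ \pi(f)=0\right\} \] (with $\inf\emptyset=+\infty$ and $e^{-\infty}=0$). Assume that $\lambda(q)>0$, i.e. that the process has the $\mathcal L^2(\pi)$-spectral gap $\lambda(q)$. Let $X=(X_t)_{t\ge0}$ be a Markov process with transition function $P_t$, initial distribution $\pi$ and almost surely right-continuous paths, and let $\mathbb P_\pi$ be its law. Then for all real $a<b$, every continuous $g:E\to[a,b]$, and all $t,\varepsilon>0$, \[ \mathbb P_\pi\left(\frac1t\int_0^t g(X_s)\,\mathrm ds-\pi(g)\ge\varepsilon\right)\le\exp\left\{-\frac{\lambda(q)\,t\,\varepsilon^2}{(b-a)^2}\right\}. \] -/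

import Mathlib

open MeasureTheory ProbabilityTheory Filter Topology
open scoped NNReal ENNReal

namespace JumpProcess

variable {E : Type*} [MeasurableSpace E]

/-- The transition function `P_t(x, A)` of a time-homogeneous jump process on `E`: a semigroup of
Markov kernels that is continuous at the origin. -/
structure IsJumpTransitionFunction (P : ℝ≥0 → Kernel E E) : Prop where
  markov : ∀ t, IsMarkovKernel (P t)
  zero : P 0 = Kernel.id
  chapman_kolmogorov : ∀ s t, P (s + t) = P t ∘ₖ P s
  continuous_at_origin : ∀ (x : E) (A : Set E), MeasurableSet A →
    Tendsto (fun t : ℝ≥0 => (P t x).real A) (𝓝[>] 0) (𝓝 (A.indicator (fun _ => (1 : ℝ)) x))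

/-- `(q(x), q(x, A))` is the `q`-pair of the transition function `P`, and it is totally stable
(`q(x) < ∞`, as `q` takes values in `ℝ≥0`) and conservative (`q(x, E) = q(x)`). The jump kernel
`q(x, A)` is written `J x A`. -/
structure IsConservativeQPair (P : ℝ≥0 → Kernel E E) (q : E → ℝ≥0) (J : Kernel E E) : Prop where
  conservative : ∀ x, J x Set.univ = (q x : ℝ≥0∞)
  derivative_at_origin : ∀ (x : E) (A : Set E), MeasurableSet A →
    Tendsto (fun t : ℝ≥0 =>
        ((P t x).real A - A.indicator (fun _ => (1 : ℝ)) x) / (t : ℝ)) (𝓝[>] 0)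
      (𝓝 ((J x).real A - (q x : ℝ) * A.indicator (fun _ => (1 : ℝ)) x))

/-- The `q`-pair is uniformly bounded: `sup_x q(x) < ∞`. -/
def UniformlyBounded {E : Type*} (q : E → ℝ≥0) : Prop := ∃ C : ℝ≥0, ∀ x, q x ≤ C

/-- The action `P_t f (x) = ∫ f(y) P_t(x, dy)` on functions. -/
noncomputable def act (P : ℝ≥0 → Kernel E E) (t : ℝ≥0) (f : E → ℝ) (x : E) : ℝ :=
  ∫ y, f y ∂(P t x)

/-- `f` belongs to the domain of the infinitesimal generator `𝒜` of `P` on `L²(π)`, and `𝒜 f = h`: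
`f, h ∈ L²(π)` and `(P_t f - f) / t → h` in `L²(π)` as `t ↓ 0`. -/
structure IsGeneratorValue (P : ℝ≥0 → Kernel E E) (π : Measure E) (f h : E → ℝ) : Prop where
  memLp : MemLp f 2 π
  memLp_value : MemLp h 2 π
  tendsto : Tendsto
    (fun t : ℝ≥0 => eLpNorm (fun x => (act P t f x - f x) / (t : ℝ) - h x) 2 π) (𝓝[>] 0) (𝓝 0)

/-- `inf {-⟨𝒜 f, f⟩_π : f ∈ D(𝒜), ‖f‖_{π,2} = 1, π(f) = 0}`, as an extended real number
(so that the infimum over the empty set is `+∞`). -/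
noncomputable def spectralGap (P : ℝ≥0 → Kernel E E) (π : Measure E) : EReal :=
  sInf {r : EReal | ∃ f h : E → ℝ, IsGeneratorValue P π f h ∧
    eLpNorm f 2 π = 1 ∧ ∫ x, f x ∂π = 0 ∧ r = ((-∫ x, h x * f x ∂π : ℝ) : EReal)}

/-- The `σ`-algebra generated by `X_u`, `u ≤ s`. -/
@[reducible] def past {Ω : Type*} (X : ℝ≥0 → Ω → E) (s : ℝ≥0) : MeasurableSpace Ω :=
  ⨆ u : ℝ≥0, ⨆ _ : u ≤ s, MeasurableSpace.comap (X u) inferInstance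

/-- Under `Pr`, the process `X` is a Markov process with transition function `P`, initial
distribution `π` and almost surely right-continuous paths. -/
structure IsMarkovProcess [TopologicalSpace E] {Ω : Type*} [MeasurableSpace Ω] (Pr : Measure Ω)
    (X : ℝ≥0 → Ω → E) (P : ℝ≥0 → Kernel E E) (π : Measure E) : Prop where
  measurable : ∀ t, Measurable (X t)
  initial : Pr.map (X 0) = π
  markov_property : ∀ (s t : ℝ≥0) (A : Set E), MeasurableSet A →
    Pr[(X (s + t) ⁻¹' A).indicator (fun _ => (1 : ℝ)) | past X s]
      =ᵐ[Pr] fun ω => (P t (X s ω)).real A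
  right_continuous : ∀ᵐ ω ∂Pr, ∀ s : ℝ≥0, ContinuousWithinAt (fun u => X u ω) (Set.Ici s) s

end JumpProcess

/-! This is Chernoff's bound, with the exponential moment controlled on a time skeleton. For step h
put T_h f = exp(θh(g - π(g))) · P_h f. The moment of θh ∑ (g(X_{ih}) - π(g)) is the π-integral of a
power of T_h applied to 1 (`lintegral_prod_mul`), hence at most that power of the L²(π) norm of T_h.

One step is estimated to first order in h (`integral_tilt_sq_le`). Let F = P_h f, N = π(F²), V the
variance of F under π, D = b - a. Expanding the exponential gives ‖T_h f‖² ≤ N + 2θh ∫ (g - π(g)) F²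
dπ + O(h²)N. The integral is at most D√(NV) (`integral_sub_mul_sq_le`), AM-GM turns θD√(NV) into lV
+ θ²D²N/(4l), and a lower bound l > 0 of the gap gives N + 2lhV ≤ ‖f‖² (`integral_act_sq_add_le`),
which absorbs the variance. So ‖T_h‖² ≤ 1 + 2hθ²D²/(4l) + O(h²); letting h → 0 by Fatou and
optimising θ gives the exponent.

Reversibility plays no role: the decay of ‖P_t f‖² follows from its right derivative 2⟨𝒜 P_t f, P_t
f⟩ and Grönwall. Boundedness of q puts every bounded measurable function in the domain of 𝒜, so the
variational gap applies to each P_t f. Underlying this is P_t(x, B) ≥ 1 - q(x)t for measurable B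
containing x (`one_sub_le`). -/

namespace JumpProcess

/-! ### Transition operators on bounded functions and the linear bound on leaving a set -/

variable {E : Type*} [MeasurableSpace E] {P : ℝ≥0 → Kernel E E} {q : E → ℝ≥0} {J : Kernel E E}

theorem integrable_of_abs_le {α : Type*} [MeasurableSpace α] {μ : Measure α} [IsFiniteMeasure μ]
    {f : α → ℝ} (hf : Measurable f) {M : ℝ} (hM : ∀ x, |f x| ≤ M) : Integrable f μ :=
  Integrable.of_bound hf.aestronglyMeasurable M (ae_of_all _ hM)

theorem abs_integral_le_of_abs_le {α : Type*} [MeasurableSpace α] {μ : Measure α}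
    [IsProbabilityMeasure μ] {f : α → ℝ} {M : ℝ} (hM : ∀ x, |f x| ≤ M) : |∫ x, f x ∂μ| ≤ M := by
  simpa using norm_integral_le_of_norm_le_const (μ := μ) (f := f) (C := M) (ae_of_all _ hM)

theorem measurable_act (t : ℝ≥0) {f : E → ℝ} (hf : Measurable f) : Measurable (act P t f) :=
  (hf.stronglyMeasurable.integral_kernel (κ := P t)).measurable

theorem IsJumpTransitionFunction.abs_act_le (hP : IsJumpTransitionFunction P) (t : ℝ≥0) {f : E → ℝ}
    {M : ℝ} (hM : ∀ x, |f x| ≤ M) (x : E) : |act P t f x| ≤ M := by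
  have := hP.markov t
  exact abs_integral_le_of_abs_le hM

theorem IsJumpTransitionFunction.act_zero (hP : IsJumpTransitionFunction P) {f : E → ℝ}
    (hf : Measurable f) : act P 0 f = f := by
  ext x
  simp only [act, hP.zero, Kernel.id_apply]
  exact integral_dirac' _ _ hf.stronglyMeasurable

theorem IsJumpTransitionFunction.act_add (hP : IsJumpTransitionFunction P) (s t : ℝ≥0) {f : E → ℝ}
    (hf : Measurable f) {M : ℝ} (hM : ∀ x, |f x| ≤ M) :
    act P (s + t) f = act P s (act P t f) := by
  ext x
  have := hP.markov t
  have := hP.markov s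
  simp only [act, hP.chapman_kolmogorov]
  exact Kernel.integral_comp (integrable_of_abs_le hf hM)

theorem integral_act {π : Measure E} [IsProbabilityMeasure π] {t : ℝ≥0} [IsMarkovKernel (P t)]
    (hπ : Kernel.Invariant (P t) π) {f : E → ℝ} (hf : Measurable f) {M : ℝ}
    (hM : ∀ x, |f x| ≤ M) : ∫ x, act P t f x ∂π = ∫ x, f x ∂π := by
  have e : (P t ∘ₖ Kernel.const Unit π) () = π := by
    rw [Kernel.comp_apply, Kernel.const_apply]; exact hπ
  have := Kernel.integral_comp (η := P t) (κ := Kernel.const Unit π) (a := ())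
    (integrable_of_abs_le hf hM)
  rw [e, Kernel.const_apply] at this
  exact this.symm

/-- Along multiples of `s`, staying in a set that reads off the values of the iterates bounds the
transition function from below. -/
theorem IsJumpTransitionFunction.pow_le (hP : IsJumpTransitionFunction P) (x : E) {B S : Set E}
    (hB : MeasurableSet B) (hS : MeasurableSet S) (hx : x ∈ B) (s : ℝ≥0) (n : ℕ)
    (hSB : ∀ y ∈ S, ∀ k < n, (P (k * s) y).real B = (P (k * s) x).real B) {k : ℕ} (hk : k ≤ n) :
    (P s x).real S ^ k ≤ (P (k * s) x).real B := by
  induction k with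
  | zero => simp [hP.zero, Kernel.id_apply, measureReal_def, hB, hx]
  | succ k ih =>
    have := hP.markov s
    have := hP.markov (k * s)
    have e : ((k + 1 : ℕ) : ℝ≥0) * s = s + k * s := by push_cast; ring
    have hm : Measurable (B.indicator (fun _ => (1 : ℝ))) := measurable_const.indicator hB
    have hb : ∀ y, |B.indicator (fun _ => (1 : ℝ)) y| ≤ 1 := fun y => by
      by_cases hy : y ∈ B <;> simp [hy]
    have h1 := congrFun (hP.act_add s (k * s) hm hb) x
    have h2 : ∀ r y, act P r (B.indicator (fun _ => (1 : ℝ))) y = (P r y).real B := fun r y => by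
      simp [act, integral_indicator hB]
    have h3 : act P (k * s) (B.indicator (fun _ => (1 : ℝ))) = fun y => (P (k * s) y).real B :=
      funext (h2 _)
    rw [e, ← h2, h1, h3, act, pow_succ, mul_comm]
    have h4 : Measurable fun y => (P (k * s) y).real B := h3 ▸ measurable_act (k * s) hm
    -- Restrict the Chapman–Kolmogorov integral over the first step to S, where the integrand is
    -- constant.
    calc (P s x).real S * (P s x).real S ^ k
        ≤ (P s x).real S * (P (k * s) x).real B := by gcongr; exact ih (by omega)
      _ = ∫ y in S, (P (k * s) y).real B ∂(P s x) := by
          rw [setIntegral_congr_fun hS (fun y hy => hSB y hy k (by omega))]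
          simp
      _ ≤ _ := setIntegral_le_integral
          (integrable_of_abs_le h4 (M := 1) fun y => by
            rw [abs_of_nonneg measureReal_nonneg]; exact measureReal_le_one)
          (ae_of_all _ fun y => measureReal_nonneg)

/-- The process stays in any measurable set around its starting point with probability at least
`1 - q(x) t`. -/
theorem IsConservativeQPair.one_sub_le (hP : IsJumpTransitionFunction P)
    (hq : IsConservativeQPair P q J) (x : E) {B : Set E} (hB : MeasurableSet B) (hx : x ∈ B)
    (t : ℝ≥0) : 1 - q x * t ≤ (P t x).real B := by
  rcases eq_or_ne t 0 with rfl | ht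
  · simp [hP.zero, Kernel.id_apply, measureReal_def, hB, hx]
  have htpos : (0 : ℝ) < t := by positivity
  have hmeas : ∀ r, Measurable fun y => (P r y).real B := fun r =>
    ((P r).measurable_coe hB).ennreal_toReal
  -- S replaces the singleton {x}, which need not be measurable: a countable intersection of level
  -- sets, serving all grids at once.
  set S : Set E := ⋂ n : ℕ, ⋂ k : ℕ,
    {y | (P (k * (t / (n + 1))) y).real B = (P (k * (t / (n + 1))) x).real B} with hSdef
  have hS : MeasurableSet S := MeasurableSet.iInter fun n => MeasurableSet.iInter fun k =>
    hmeas _ (measurableSet_singleton _)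
  have hxS : x ∈ S := by simp [hSdef]
  have hlim : Tendsto (fun n : ℕ => t / ((n : ℝ≥0) + 1)) atTop (𝓝[>] 0) := by
    refine tendsto_nhdsWithin_iff.2 ⟨?_, Eventually.of_forall fun n => ?_⟩
    · rw [← NNReal.tendsto_coe]
      push_cast
      simpa [div_eq_mul_inv] using (tendsto_one_div_add_atTop_nhds_zero_nat (𝕜 := ℝ)).const_mul (t : ℝ)
    · have : 0 < t := pos_iff_ne_zero.2 ht
      simp only [Set.mem_Ioi]; positivity
  have hd := ((hq.derivative_at_origin x S hS).comp hlim).const_mul (t : ℝ)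
  have hbound : ∀ n : ℕ, 1 + (t : ℝ) * (((P (t / (n + 1)) x).real S -
      S.indicator (fun _ => (1 : ℝ)) x) / ((t / ((n : ℝ≥0) + 1) : ℝ≥0) : ℝ)) ≤ (P t x).real B := by
    intro n
    have h1 := hP.pow_le x hB hS hx (t / (n + 1)) (n + 1)
      (fun y hy k _ => by
        have := Set.mem_iInter.1 (Set.mem_iInter.1 hy n) k
        exact this) le_rfl
    have e : ((n + 1 : ℕ) : ℝ≥0) * (t / (n + 1)) = t := by
      push_cast; field_simp
    rw [e] at h1
    refine le_trans ?_ h1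
    -- Bernoulli's inequality turns the power into a difference quotient of P_s(x, S) at s =
    -- t/(n+1).
    have h2 := one_add_mul_le_pow (a := (P (t / (n + 1)) x).real S - 1)
      (by linarith [measureReal_nonneg (μ := P (t / (n + 1)) x) (s := S)]) (n + 1)
    rw [add_sub_cancel] at h2
    refine le_trans (le_of_eq ?_) h2
    simp only [hxS, Set.indicator_of_mem]
    push_cast
    field_simp
  have hle := le_of_tendsto (hd.const_add 1) (Eventually.of_forall hbound)
  simp only [hxS, Set.indicator_of_mem] at hle
  -- The limiting bound is 1 + t(q(x, S) - q(x)); the term with q(x, S) is dropped.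
  have : 0 ≤ (t : ℝ) * (J x).real S := by positivity
  nlinarith

/-- The integrand f(y) - f(x) vanishes on the level set of f through x, and the process is outside
that set at time t with probability at most q(x)t. -/
theorem IsConservativeQPair.integral_abs_sub_le (hP : IsJumpTransitionFunction P)
    (hq : IsConservativeQPair P q J) {f : E → ℝ} (hf : Measurable f) {M : ℝ}
    (hM : ∀ x, |f x| ≤ M) (t : ℝ≥0) (x : E) :
    |act P t f x - f x| ≤ 2 * M * q x * t := by
  have := hP.markov t
  have hM0 : 0 ≤ M := (abs_nonneg _).trans (hM x)
  set B : Set E := {y | f y = f x}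
  have hB : MeasurableSet B := hf (measurableSet_singleton _)
  have h1 : act P t f x - f x = ∫ y in Bᶜ, (f y - f x) ∂(P t x) := by
    rw [setIntegral_eq_integral_of_forall_compl_eq_zero, integral_sub (μ := P t x)
      (integrable_of_abs_le hf hM) (integrable_const _)]
    · simp [act]
    · intro y hy
      have : f y = f x := by simpa [B] using hy
      simp [this]
  have h2 : (P t x).real Bᶜ ≤ q x * t := by
    rw [probReal_compl_eq_one_sub hB]
    linarith [hq.one_sub_le hP x hB rfl t]
  rw [h1]
  calc _ ≤ 2 * M * (P t x).real Bᶜ := by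
        refine norm_setIntegral_le_of_norm_le_const (μ := P t x) (s := Bᶜ)
          (f := fun y => f y - f x) (C := 2 * M) (measure_lt_top _ _) fun y _ => ?_
        rw [Real.norm_eq_abs]
        have := abs_sub (f y) (f x)
        linarith [hM x, hM y]
    _ ≤ 2 * M * (q x * t) := by gcongr
    _ = _ := by ring

end JumpProcess

/-! ### The generator on bounded measurable functions -/

namespace JumpProcess

variable {E : Type*} [MeasurableSpace E] {P : ℝ≥0 → Kernel E E} {q : E → ℝ≥0} {J : Kernel E E}

theorem exists_simpleFunc_abs_sub_le {f : E → ℝ} (hf : Measurable f) {M : ℝ} (hM : ∀ x, |f x| ≤ M)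
    {δ : ℝ} (hδ : 0 < δ) : ∃ g : SimpleFunc E ℝ, ∀ x, |f x - g x| ≤ δ := by
  -- Round down to multiples of δ; boundedness makes the range finite.
  have hm : Measurable fun x => δ * (⌊f x / δ⌋ : ℝ) :=
    measurable_const.mul (measurable_from_top.comp (Int.measurable_floor.comp (hf.div_const δ)))
  refine ⟨⟨fun x => δ * (⌊f x / δ⌋ : ℝ), fun y => hm (measurableSet_singleton _), ?_⟩, fun x => ?_⟩
  · refine ((Set.finite_Icc ⌊-M / δ⌋ ⌊M / δ⌋).image fun k : ℤ => δ * (k : ℝ)).subset ?_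
    rintro _ ⟨x, rfl⟩
    have := abs_le.1 (hM x)
    refine ⟨⌊f x / δ⌋, ⟨Int.floor_mono ?_, Int.floor_mono ?_⟩, rfl⟩
    · gcongr; exact this.1
    · gcongr; exact this.2
  · change |f x - δ * (⌊f x / δ⌋ : ℝ)| ≤ δ
    have h1 := Int.floor_le (f x / δ)
    have h2 := Int.lt_floor_add_one (f x / δ)
    rw [le_div_iff₀ hδ] at h1
    rw [div_lt_iff₀ hδ] at h2
    rw [abs_le]
    constructor <;> nlinarith

theorem IsConservativeQPair.isFiniteMeasure (hq : IsConservativeQPair P q J) (x : E) :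
    IsFiniteMeasure (J x) := ⟨by simp [hq.conservative]⟩

theorem IsConservativeQPair.measureReal_univ (hq : IsConservativeQPair P q J) (x : E) :
    (J x).real Set.univ = q x := by
  simp [measureReal_def, hq.conservative]

/-- The generator `f ↦ ∫ f(y) q(·, dy) - q f` attached to a `q`-pair. -/
noncomputable def gen (q : E → ℝ≥0) (J : Kernel E E) (f : E → ℝ) (x : E) : ℝ :=
  ∫ y, f y ∂(J x) - q x * f x

theorem IsConservativeQPair.measurable_gen (hq : IsConservativeQPair P q J) {f : E → ℝ}
    (hf : Measurable f) : Measurable (gen q J f) := by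
  have h1 : Measurable fun x => (q x : ℝ) := by
    simp_rw [← hq.measureReal_univ]
    exact (J.measurable_coe MeasurableSet.univ).ennreal_toReal
  exact (hf.stronglyMeasurable.integral_kernel (κ := J)).measurable.sub (h1.mul hf)

theorem IsConservativeQPair.abs_gen_le (hq : IsConservativeQPair P q J) {f : E → ℝ} {M : ℝ}
    (hM : ∀ x, |f x| ≤ M) (x : E) : |gen q J f x| ≤ 2 * M * q x := by
  have := hq.isFiniteMeasure x
  have h1 : |∫ y, f y ∂(J x)| ≤ M * q x := by
    rw [← hq.measureReal_univ x]
    exact norm_integral_le_of_norm_le_const (μ := J x) (f := f) (C := M) (ae_of_all _ hM)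
  have h2 : |(q x : ℝ) * f x| ≤ q x * M := by
    rw [abs_mul, abs_of_nonneg (NNReal.coe_nonneg (q x))]
    exact mul_le_mul_of_nonneg_left (hM x) (q x).2
  have := abs_sub (∫ y, f y ∂(J x)) ((q x : ℝ) * f x)
  rw [gen]; linarith

theorem IsConservativeQPair.abs_slope_le (hP : IsJumpTransitionFunction P)
    (hq : IsConservativeQPair P q J) {f : E → ℝ} (hf : Measurable f) {M : ℝ}
    (hM : ∀ x, |f x| ≤ M) (t : ℝ≥0) (x : E) :
    |(act P t f x - f x) / t| ≤ 2 * M * q x := by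
  have hM0 : 0 ≤ M := (abs_nonneg _).trans (hM x)
  rw [abs_div, abs_of_nonneg (NNReal.coe_nonneg t)]
  -- This covers t = 0, where the quotient is 0 by convention.
  exact div_le_of_le_mul₀ t.2 (by positivity) (hq.integral_abs_sub_le hP hf hM t x)

theorem IsConservativeQPair.tendsto_slope_simpleFunc (hP : IsJumpTransitionFunction P)
    (hq : IsConservativeQPair P q J) (f : SimpleFunc E ℝ) (x : E) :
    Tendsto (fun t : ℝ≥0 => (act P t f x - f x) / (t : ℝ)) (𝓝[>] 0) (𝓝 (gen q J f x)) := by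
  have := hq.isFiniteMeasure x
  induction f using SimpleFunc.induction with
  | const c hs =>
    rename_i s
    have e : ∀ μ : Measure E, ∫ y, (SimpleFunc.piecewise s hs (SimpleFunc.const E c)
        (SimpleFunc.const E 0)) y ∂μ = μ.real s * c := fun μ => by
      simp [SimpleFunc.coe_piecewise, Set.piecewise_eq_indicator, integral_indicator hs]
    have e' : (SimpleFunc.piecewise s hs (SimpleFunc.const E c) (SimpleFunc.const E 0)) x =
        s.indicator (fun _ => (1 : ℝ)) x * c := by
      by_cases hx : x ∈ s <;> simp [hx]
    simp only [act, gen, e, e']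
    convert (hq.derivative_at_origin x s hs).mul_const c using 2 <;> ring
  | add _ hf hg =>
    rename_i f g _
    have hi : ∀ (μ : Measure E) [IsFiniteMeasure μ] (f : SimpleFunc E ℝ), Integrable f μ :=
      fun μ _ f => f.integrable_of_isFiniteMeasure
    have e : gen q J (f + g) x = gen q J f x + gen q J g x := by
      simp only [gen, Pi.add_apply]
      rw [integral_add (hi _ f) (hi _ g)]; ring
    rw [SimpleFunc.coe_add, e]
    refine (hf.add hg).congr fun t => ?_
    have := hP.markov t
    simp only [act, Pi.add_apply]
    rw [integral_add (hi _ f) (hi _ g)]; ring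

/-- For bounded measurable functions the transition function is differentiable at the origin,
pointwise, with derivative given by the `q`-pair. -/
theorem IsConservativeQPair.tendsto_slope (hP : IsJumpTransitionFunction P)
    (hq : IsConservativeQPair P q J) {f : E → ℝ} (hf : Measurable f) {M : ℝ}
    (hM : ∀ x, |f x| ≤ M) (x : E) :
    Tendsto (fun t : ℝ≥0 => (act P t f x - f x) / (t : ℝ)) (𝓝[>] 0) (𝓝 (gen q J f x)) := by
  have := hq.isFiniteMeasure x
  rw [Metric.tendsto_nhds]
  intro ε hε
  -- Replacing f by g changes the slope and the generator by at most 2δq(x) each, less than ε/2 in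
  -- total; the +1 allows q(x) = 0.
  set δ : ℝ := ε / (8 * (q x + 1)) with hδ
  have hδ0 : 0 < δ := by positivity
  have hδε : 8 * (δ * q x) < ε := by
    rw [hδ, div_mul_eq_mul_div, mul_div_assoc', div_lt_iff₀ (by positivity)]
    nlinarith [(q x).coe_nonneg, mul_nonneg hε.le (q x).coe_nonneg]
  obtain ⟨g, hg⟩ := exists_simpleFunc_abs_sub_le hf hM hδ0
  filter_upwards [Metric.tendsto_nhds.1 (hq.tendsto_slope_simpleFunc hP g x) (ε / 2) (by positivity)]
    with t ht
  have := hP.markov t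
  have hd : Measurable fun y => f y - g y := hf.sub g.measurable
  have h1 := hq.abs_slope_le hP hd hg t x
  have h2 := hq.abs_gen_le hg x
  have hi : ∀ (μ : Measure E) [IsFiniteMeasure μ], Integrable g μ :=
    fun μ _ => g.integrable_of_isFiniteMeasure
  have e1 : act P t (fun y => f y - g y) x = act P t f x - act P t g x :=
    integral_sub (integrable_of_abs_le hf hM) (hi _)
  have e2 : gen q J (fun y => f y - g y) x = gen q J f x - gen q J g x := by
    simp only [gen]
    rw [integral_sub (integrable_of_abs_le hf hM) (hi _)]; ring
  rw [e1] at h1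
  rw [e2] at h2
  rw [Real.dist_eq] at ht ⊢
  have e3 : (act P t f x - f x) / (t : ℝ) - gen q J f x =
      (act P t f x - act P t g x - (f x - g x)) / t + ((act P t g x - g x) / t - gen q J g x)
        - (gen q J f x - gen q J g x) := by ring
  rw [e3]
  have h3 := abs_sub ((act P t f x - act P t g x - (f x - g x)) / t +
    ((act P t g x - g x) / t - gen q J g x)) (gen q J f x - gen q J g x)
  have h4 := abs_add_le ((act P t f x - act P t g x - (f x - g x)) / (t : ℝ))
    ((act P t g x - g x) / t - gen q J g x)
  linarith

/-- When the `q`-pair is bounded, every bounded measurable function is in the domain of the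
`L²`-generator. -/
theorem IsConservativeQPair.isGeneratorValue (hP : IsJumpTransitionFunction P)
    (hq : IsConservativeQPair P q J) {C : ℝ≥0} (hC : ∀ x, q x ≤ C) (π : Measure E)
    [IsProbabilityMeasure π] {f : E → ℝ} (hf : Measurable f) {M : ℝ} (hM : ∀ x, |f x| ≤ M) :
    IsGeneratorValue P π f (gen q J f) := by
  -- A point is needed to infer 0 ≤ M from the pointwise bound.
  rcases isEmpty_or_nonempty E with hE | ⟨⟨x₀⟩⟩
  · exact absurd (measure_univ (μ := π)) (by simp [Set.eq_empty_of_isEmpty])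
  have hM0 : 0 ≤ M := (abs_nonneg _).trans (hM x₀)
  have hgen : ∀ x, |gen q J f x| ≤ 2 * M * C := fun x =>
    (hq.abs_gen_le hM x).trans (by gcongr; exact hC x)
  have hslope : ∀ (t : ℝ≥0) x, |(act P t f x - f x) / t| ≤ 2 * M * C := fun t x =>
    (hq.abs_slope_le hP hf hM t x).trans (by gcongr; exact hC x)
  refine ⟨MemLp.of_bound hf.aestronglyMeasurable M (ae_of_all _ hM),
    MemLp.of_bound (hq.measurable_gen hf).aestronglyMeasurable _ (ae_of_all _ hgen), ?_⟩
  simp_rw [eLpNorm_eq_lintegral_rpow_enorm_toReal (two_ne_zero) (ENNReal.ofNat_ne_top)]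
  have key : Tendsto (fun t : ℝ≥0 => ∫⁻ x, ‖(act P t f x - f x) / (t : ℝ) - gen q J f x‖ₑ ^
      (2 : ℝ≥0∞).toReal ∂π) (𝓝[>] 0) (𝓝 (∫⁻ x, 0 ∂π)) := by
    refine tendsto_lintegral_filter_of_dominated_convergence
      (fun _ => ENNReal.ofReal (4 * M * C) ^ (2 : ℝ)) (Eventually.of_forall fun t => ?_)
      (Eventually.of_forall fun t => ae_of_all _ fun x => ?_) ?_ (ae_of_all _ fun x => ?_)
    · have := measurable_act (P := P) t hf
      have := hq.measurable_gen hf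
      fun_prop
    · rw [ENNReal.toReal_ofNat]
      gcongr
      rw [Real.enorm_eq_ofReal_abs]
      refine ENNReal.ofReal_le_ofReal ?_
      have := abs_sub ((act P t f x - f x) / (t : ℝ)) (gen q J f x)
      linarith [hgen x, hslope t x]
    · simp
    · have h := ((hq.tendsto_slope hP hf hM x).sub_const (gen q J f x)).enorm
      rw [sub_self, enorm_zero] at h
      have := (ENNReal.continuous_rpow_const (y := (2 : ℝ≥0∞).toReal)).continuousAt.tendsto.comp h
      simpa [Function.comp_def] using this
  have := (ENNReal.continuous_rpow_const (y := 1 / (2 : ℝ≥0∞).toReal)).continuousAt.tendsto.comp key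
  simpa [Function.comp_def] using this

end JumpProcess

/-! ### Poincaré inequality and exponential L² decay -/

namespace JumpProcess

variable {E : Type*} [MeasurableSpace E] {P : ℝ≥0 → Kernel E E} {q : E → ℝ≥0} {J : Kernel E E}
  {π : Measure E} [IsProbabilityMeasure π] {l : ℝ}

theorem gen_const_mul (c : ℝ) (f : E → ℝ) (x : E) :
    gen q J (fun y => c * f y) x = c * gen q J f x := by
  simp only [gen, integral_const_mul]; ring

theorem abs_sq_le_of_abs_le {a M : ℝ} (h : |a| ≤ M) : |a ^ 2| ≤ M ^ 2 := by
  rw [abs_pow]; gcongr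

/-- The Poincaré inequality for bounded centred functions. -/
theorem IsConservativeQPair.integral_gen_mul_le (hP : IsJumpTransitionFunction P)
    (hq : IsConservativeQPair P q J) {C : ℝ≥0} (hC : ∀ x, q x ≤ C)
    (hl : (l : EReal) ≤ spectralGap P π) {f : E → ℝ} (hf : Measurable f) {M : ℝ}
    (hM : ∀ x, |f x| ≤ M) (h0 : ∫ x, f x ∂π = 0) :
    ∫ x, gen q J f x * f x ∂π ≤ -l * ∫ x, f x ^ 2 ∂π := by
  set N := ∫ x, f x ^ 2 ∂π with hN
  have hsq : Integrable (fun x => f x ^ 2) π :=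
    integrable_of_abs_le (hf.pow_const 2) (M := M ^ 2) fun x => abs_sq_le_of_abs_le (hM x)
  have hN0 : 0 ≤ N := integral_nonneg fun x => sq_nonneg _
  rcases hN0.eq_or_lt with hN0 | hN0
  -- A null function cannot be normalised, but then both sides vanish.
  · have h1 : (fun x => f x ^ 2) =ᵐ[π] 0 :=
      (integral_eq_zero_iff_of_nonneg (fun x => sq_nonneg _) hsq).1 hN0.symm
    have h2 : ∫ x, gen q J f x * f x ∂π = 0 := by
      rw [integral_eq_zero_of_ae]
      filter_upwards [h1] with x hx
      have : f x = 0 := by simpa using hx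
      simp [this]
    rw [h2, ← hN0, mul_zero]
  set c : ℝ := (√N)⁻¹ with hc
  have hcN : c ^ 2 * N = 1 := by
    rw [hc, inv_pow, Real.sq_sqrt hN0.le, inv_mul_cancel₀ hN0.ne']
  have hg := hq.isGeneratorValue hP hC π (hf.const_mul c) (M := |c| * M) fun x => by
    rw [abs_mul]; gcongr; exact hM x
  have hnorm : eLpNorm (fun x => c * f x) 2 π = 1 := by
    rw [hg.memLp.eLpNorm_eq_integral_rpow_norm two_ne_zero ENNReal.ofNat_ne_top]
    simp only [ENNReal.toReal_ofNat, Real.norm_eq_abs, Real.rpow_two, sq_abs, mul_pow,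
      integral_const_mul]
    rw [← hN, hcN]; simp
  have hmean : ∫ x, c * f x ∂π = 0 := by rw [integral_const_mul, h0, mul_zero]
  have h := hl.trans (sInf_le ⟨_, _, hg, hnorm, hmean, rfl⟩)
  rw [EReal.coe_le_coe_iff] at h
  have e : ∫ x, gen q J (fun x => c * f x) x * (c * f x) ∂π =
      c ^ 2 * ∫ x, gen q J f x * f x ∂π := by
    rw [← integral_const_mul]
    congr 1; ext x; rw [gen_const_mul]; ring
  rw [e] at h
  have h1 := mul_le_mul_of_nonneg_right h hN0.le
  have h2 : c ^ 2 * (∫ x, gen q J f x * f x ∂π) * N = ∫ x, gen q J f x * f x ∂π := by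
    rw [mul_right_comm, hcN, one_mul]
  linarith

/-- The right derivative of `t ↦ ‖P_t f‖²` for bounded `f`. -/
theorem IsConservativeQPair.tendsto_slope_integral_sq (hP : IsJumpTransitionFunction P)
    (hq : IsConservativeQPair P q J) {C : ℝ≥0} (hC : ∀ x, q x ≤ C) {f : E → ℝ} (hf : Measurable f)
    {M : ℝ} (hM : ∀ x, |f x| ≤ M) :
    Tendsto (fun t : ℝ≥0 => (t : ℝ)⁻¹ * (∫ x, act P t f x ^ 2 ∂π - ∫ x, f x ^ 2 ∂π)) (𝓝[>] 0)
      (𝓝 (2 * ∫ x, gen q J f x * f x ∂π)) := by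
  have hM' : ∀ t x, |act P t f x| ≤ M := fun t => hP.abs_act_le t hM
  have hm : ∀ t, Measurable (act P t f) := fun t => measurable_act t hf
  -- Factoring the difference of squares leaves a bounded slope times a bounded sum, so dominated
  -- convergence applies.
  have e : ∀ t : ℝ≥0, (t : ℝ)⁻¹ * (∫ x, act P t f x ^ 2 ∂π - ∫ x, f x ^ 2 ∂π) =
      ∫ x, (act P t f x - f x) / t * (act P t f x + f x) ∂π := fun t => by
    rw [← integral_sub (integrable_of_abs_le ((hm t).pow_const 2) (M := M ^ 2)
      fun x => abs_sq_le_of_abs_le (hM' t x)) (integrable_of_abs_le (hf.pow_const 2) (M := M ^ 2)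
      fun x => abs_sq_le_of_abs_le (hM x)), ← integral_const_mul]
    congr 1; ext x; ring
  simp_rw [e, ← integral_const_mul]
  refine tendsto_integral_filter_of_dominated_convergence (fun _ => (2 * M * C) * (2 * M))
    (Eventually.of_forall fun t => ?_) (Eventually.of_forall fun t => ae_of_all _ fun x => ?_)
    (integrable_const _) (ae_of_all _ fun x => ?_)
  · exact ((((hm t).sub hf).div_const _).mul ((hm t).add hf)).aestronglyMeasurable
  · have hM0 : 0 ≤ M := (abs_nonneg _).trans (hM x)
    rw [Real.norm_eq_abs, abs_mul]
    gcongr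
    · exact (hq.abs_slope_le hP hf hM t x).trans (by gcongr; exact hC x)
    · have := abs_add_le (act P t f x) (f x)
      linarith [hM x, hM' t x]
  · have h1 := hq.tendsto_slope hP hf hM x
    have h2 : Tendsto (fun t : ℝ≥0 => act P t f x) (𝓝[>] 0) (𝓝 (f x)) := by
      have h3 : Tendsto (fun t : ℝ≥0 => (t : ℝ)) (𝓝[>] 0) (𝓝 0) :=
        (NNReal.continuous_coe.tendsto' 0 0 rfl).mono_left nhdsWithin_le_nhds
      have h4 := (h3.mul h1).add_const (f x)
      rw [zero_mul, zero_add] at h4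
      refine h4.congr' ?_
      filter_upwards [self_mem_nhdsWithin] with t ht
      have : (t : ℝ) ≠ 0 := by exact_mod_cast (ne_of_gt ht : t ≠ 0)
      field_simp; ring
    convert h1.mul (h2.add_const (f x)) using 2; ring

/-- By the semigroup property and q ≤ C, each t ↦ P_t f(x) is Lipschitz with constant 2MC. Grönwall
needs this continuity, as only right derivatives are available. -/
theorem IsConservativeQPair.continuous_integral_sq (hP : IsJumpTransitionFunction P)
    (hq : IsConservativeQPair P q J) {C : ℝ≥0} (hC : ∀ x, q x ≤ C) {f : E → ℝ} (hf : Measurable f)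
    {M : ℝ} (hM : ∀ x, |f x| ≤ M) :
    Continuous fun t : ℝ≥0 => ∫ x, act P t f x ^ 2 ∂π := by
  have hM' : ∀ t x, |act P t f x| ≤ M := fun t => hP.abs_act_le t hM
  have hm : ∀ t, Measurable (act P t f) := fun t => measurable_act t hf
  refine continuous_of_dominated (bound := fun _ => M ^ 2)
    (fun t => ((hm t).pow_const 2).aestronglyMeasurable)
    (fun t => ae_of_all _ fun x => abs_sq_le_of_abs_le (hM' t x)) (integrable_const _)
    (ae_of_all _ fun x => ?_)
  have hM0 : 0 ≤ M := (abs_nonneg _).trans (hM x)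
  refine Continuous.pow ?_ 2
  have key : ∀ s t : ℝ≥0, s ≤ t → |act P t f x - act P s f x| ≤ 2 * M * C * (t - s) := by
    intro s t hst
    have h := hP.act_add s (t - s) hf hM
    have := hP.markov s
    rw [add_tsub_cancel_of_le hst] at h
    rw [h]
    have e : act P s (act P (t - s) f) x - act P s f x =
        ∫ y, (act P (t - s) f y - f y) ∂(P s x) :=
      (integral_sub (integrable_of_abs_le (hm _) (hM' _)) (integrable_of_abs_le hf hM)).symm
    rw [e]
    refine abs_integral_le_of_abs_le fun y => (hq.integral_abs_sub_le hP hf hM _ y).trans ?_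
    rw [NNReal.coe_sub hst]
    have : (s : ℝ) ≤ t := hst
    have : 0 ≤ (t : ℝ) - s := sub_nonneg.2 this
    gcongr
    exact hC y
  refine (LipschitzWith.of_dist_le_mul (K := (2 * M * C).toNNReal) fun s t => ?_).continuous
  rw [Real.coe_toNNReal _ (by positivity), Real.dist_eq, NNReal.dist_eq]
  rcases le_total s t with h | h
  · rw [abs_sub_comm, abs_sub_comm (s : ℝ), abs_of_nonneg (sub_nonneg.2 (NNReal.coe_le_coe.2 h))]
    exact key s t h
  · rw [abs_of_nonneg (sub_nonneg.2 (NNReal.coe_le_coe.2 h))]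
    exact key t s h

/-- The spectral gap makes the transition function contract centred functions exponentially. -/
theorem IsConservativeQPair.integral_act_sq_le (hP : IsJumpTransitionFunction P)
    (hq : IsConservativeQPair P q J) {C : ℝ≥0} (hC : ∀ x, q x ≤ C)
    (hπ : ∀ t, Kernel.Invariant (P t) π) (hl : (l : EReal) ≤ spectralGap P π)
    {f : E → ℝ} (hf : Measurable f) {M : ℝ} (hM : ∀ x, |f x| ≤ M) (h0 : ∫ x, f x ∂π = 0)
    (t : ℝ≥0) :
    ∫ x, act P t f x ^ 2 ∂π ≤ Real.exp (-2 * l * t) * ∫ x, f x ^ 2 ∂π := by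
  have hM' : ∀ t x, |act P t f x| ≤ M := fun t => hP.abs_act_le t hM
  have hm : ∀ t, Measurable (act P t f) := fun t => measurable_act t hf
  have hcont : Continuous fun r : ℝ => ∫ x, act P r.toNNReal f x ^ 2 ∂π :=
    (hq.continuous_integral_sq hP hC hf hM).comp continuous_real_toNNReal
  have h := le_gronwallBound_of_liminf_deriv_right_le (a := 0) (b := t) (ε := 0) (K := -2 * l)
    (δ := ∫ x, f x ^ 2 ∂π) (f := fun r : ℝ => ∫ x, act P r.toNNReal f x ^ 2 ∂π)
    (f' := fun r => 2 * ∫ x, gen q J (act P r.toNNReal f) x * act P r.toNNReal f x ∂π)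
    hcont.continuousOn ?_ ?_ ?_ t ⟨t.2, le_rfl⟩
  · rw [gronwallBound_ε0, sub_zero, Real.toNNReal_coe, mul_comm] at h
    exact h
  · intro r hr R hR
    have h1 := hq.tendsto_slope_integral_sq (π := π) hP hC (hm r.toNNReal) (hM' r.toNNReal)
    have h2 : Tendsto (fun z : ℝ => (z - r).toNNReal) (𝓝[>] r) (𝓝[>] 0) := by
      refine tendsto_nhdsWithin_iff.2 ⟨?_, ?_⟩
      · have : Continuous fun z : ℝ => (z - r).toNNReal := by fun_prop
        exact (this.tendsto' r 0 (by simp)).mono_left nhdsWithin_le_nhds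
      · filter_upwards [self_mem_nhdsWithin] with z hz
        simpa using hz
    have h3 := ((h1.comp h2).eventually_lt_const hR)
    refine Eventually.frequently ?_
    filter_upwards [h3, self_mem_nhdsWithin] with z hz hzr
    have hzr' : 0 ≤ z - r := sub_nonneg.2 (le_of_lt hzr)
    -- The right derivative at r is the one at the origin for the function P_r f.
    have e : z.toNNReal = (z - r).toNNReal + r.toNNReal := by
      rw [← Real.toNNReal_add hzr' hr.1, sub_add_cancel]
    rw [Function.comp_apply, ← hP.act_add _ _ hf hM, ← e, Real.coe_toNNReal _ hzr'] at hz
    exact hz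
  · simp [hP.act_zero hf]
  · intro r _
    have := hP.markov r.toNNReal
    have := hq.integral_gen_mul_le hP hC hl (hm r.toNNReal) (hM' r.toNNReal)
      ((integral_act (hπ _) hf hM).trans h0)
    linarith

end JumpProcess

/-! ### Le Cam type bound and one step of the tilted operator -/

namespace JumpProcess

theorem integral_abs_mul_abs_le {α : Type*} [MeasurableSpace α] {μ : Measure α} [IsFiniteMeasure μ]
    {f g : α → ℝ} (hf : Measurable f) (hg : Measurable g) {A B : ℝ} (hA : ∀ x, |f x| ≤ A)
    (hB : ∀ x, |g x| ≤ B) :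
    ∫ x, |f x| * |g x| ∂μ ≤ √(∫ x, f x ^ 2 ∂μ) * √(∫ x, g x ^ 2 ∂μ) := by
  have h := integral_mul_le_Lp_mul_Lq_of_nonneg (μ := μ) Real.HolderConjugate.two_two
    (f := fun x => |f x|) (g := fun x => |g x|) (ae_of_all _ fun x => abs_nonneg _)
    (ae_of_all _ fun x => abs_nonneg _)
    (MemLp.of_bound hf.abs.aestronglyMeasurable A (ae_of_all _ fun x => by simpa using hA x))
    (MemLp.of_bound hg.abs.aestronglyMeasurable B (ae_of_all _ fun x => by simpa using hB x))
  simpa [Real.sqrt_eq_rpow] using h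

/-- The Le Cam type bound of `∫ (g - π g) F²` through the variance of `F`. -/
theorem integral_sub_mul_sq_le {α : Type*} [MeasurableSpace α] {μ : Measure α}
    [IsProbabilityMeasure μ] {g F : α → ℝ} (hg : Measurable g) (hF : Measurable F) {a b B : ℝ}
    (hab : a ≤ b) (hgab : ∀ x, g x ∈ Set.Icc a b) (hB : ∀ x, |F x| ≤ B) :
    ∫ x, (g x - ∫ y, g y ∂μ) * F x ^ 2 ∂μ ≤
      (b - a) * (√(∫ x, F x ^ 2 ∂μ) * √(∫ x, F x ^ 2 ∂μ - (∫ x, F x ∂μ) ^ 2)) := by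
  set m := ∫ y, g y ∂μ
  set N := ∫ x, F x ^ 2 ∂μ with hN
  set c := ∫ x, F x ∂μ with hc
  have hN0 : 0 ≤ N := integral_nonneg fun x => sq_nonneg _
  have hαN : √N ^ 2 = N := Real.sq_sqrt hN0
  have hgB : ∀ x, |g x| ≤ |a| + |b| := fun x => by
    rw [abs_le]
    constructor <;> linarith [(hgab x).1, (hgab x).2, neg_abs_le a, le_abs_self b, abs_nonneg a,
      abs_nonneg b]
  have ig : Integrable g μ := integrable_of_abs_le hg hgB
  have iF : Integrable F μ := integrable_of_abs_le hF hB
  have iF2 : Integrable (fun x => F x ^ 2) μ :=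
    integrable_of_abs_le (hF.pow_const 2) (M := B ^ 2) fun x => abs_sq_le_of_abs_le (hB x)
  have igF : Integrable (fun x => g x * F x ^ 2) μ :=
    integrable_of_abs_le (hg.mul (hF.pow_const 2)) (M := (|a| + |b|) * B ^ 2) fun x => by
      rw [abs_mul]
      exact mul_le_mul (hgB x) (abs_sq_le_of_abs_le (hB x)) (abs_nonneg _) (by positivity)
  -- As F² - N has mean zero, g may be centred at the midpoint, where its deviation is at most (b -
  -- a)/2.
  have e1 : ∫ x, (g x - m) * F x ^ 2 ∂μ = ∫ x, (g x - (a + b) / 2) * (F x ^ 2 - N) ∂μ := by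
    have e2 : ∫ x, (g x - m) * F x ^ 2 ∂μ = ∫ x, g x * F x ^ 2 ∂μ - m * N := by
      simp_rw [sub_mul]
      rw [integral_sub igF (iF2.const_mul m), integral_const_mul]
    have e3 : ∫ x, (g x - (a + b) / 2) * (F x ^ 2 - N) ∂μ = ∫ x, g x * F x ^ 2 ∂μ - m * N := by
      have : ∀ x, (g x - (a + b) / 2) * (F x ^ 2 - N) =
          g x * F x ^ 2 - N * g x - (a + b) / 2 * F x ^ 2 + (a + b) / 2 * N := fun x => by ring
      simp_rw [this]
      have i1 : Integrable (fun x => g x * F x ^ 2 - N * g x) μ := igF.sub (ig.const_mul N)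
      have i2 : Integrable (fun x => g x * F x ^ 2 - N * g x - (a + b) / 2 * F x ^ 2) μ :=
        i1.sub (iF2.const_mul _)
      rw [integral_add i2 (integrable_const _), integral_sub i1 (iF2.const_mul _),
        integral_sub igF (ig.const_mul N), integral_const_mul, integral_const_mul]
      simp only [integral_const, probReal_univ, smul_eq_mul, one_mul]
      rw [← hN]; ring
    rw [e2, e3]
  have bd : ∀ s : ℝ, ∀ x, |F x + s| ≤ B + |s| := fun s x =>
    (abs_add_le _ _).trans (by linarith [hB x])
  have sqr : ∀ s : ℝ, ∫ x, (F x + s) ^ 2 ∂μ = N + 2 * s * c + s ^ 2 := fun s => by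
    have : ∀ x, (F x + s) ^ 2 = F x ^ 2 + 2 * s * F x + s ^ 2 := fun x => by ring
    simp_rw [this]
    have i1 : Integrable (fun x => F x ^ 2 + 2 * s * F x) μ := iF2.add (iF.const_mul _)
    rw [integral_add i1 (integrable_const _),
      integral_add iF2 (iF.const_mul _), integral_const_mul]
    simp [N, c]
  -- Cauchy–Schwarz: the squared norms 2N ± 2c√N multiply to 4N(N - c²).
  have hprod : ∫ x, |F x + √N| * |F x + -√N| ∂μ ≤ 2 * (√N * √(N - c ^ 2)) := by
    refine (integral_abs_mul_abs_le (hF.add_const _) (hF.add_const _) (bd _) (bd _)).trans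
      (le_of_eq ?_)
    have h1 : 0 ≤ ∫ x, (F x + √N) ^ 2 ∂μ := integral_nonneg fun x => sq_nonneg _
    rw [← Real.sqrt_mul h1, sqr, sqr]
    have e4 : (N + 2 * √N * c + √N ^ 2) * (N + 2 * -√N * c + (-√N) ^ 2) =
        (2 ^ 2 * N) * (N - c ^ 2) := by
      rw [neg_sq, hαN]
      linear_combination (-4 * c ^ 2) * hαN
    rw [e4, Real.sqrt_mul (by positivity), Real.sqrt_mul (by positivity),
      Real.sqrt_sq (by norm_num)]
    ring
  have hpt : ∀ x, (g x - (a + b) / 2) * (F x ^ 2 - N) ≤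
      (b - a) / 2 * (|F x + √N| * |F x + -√N|) := fun x => by
    rw [← abs_mul]
    have e5 : (F x + √N) * (F x + -√N) = F x ^ 2 - N := by linear_combination -hαN
    rw [e5]
    refine (le_abs_self _).trans ?_
    rw [abs_mul]
    gcongr
    rw [abs_le]
    constructor <;> linarith [(hgab x).1, (hgab x).2]
  have imid : Integrable (fun x => (g x - (a + b) / 2) * (F x ^ 2 - N)) μ :=
    integrable_of_abs_le ((hg.sub_const _).mul ((hF.pow_const 2).sub_const _))
      (M := (b - a) / 2 * (B ^ 2 + N)) fun x => by
      rw [abs_mul]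
      have h1 : |g x - (a + b) / 2| ≤ (b - a) / 2 := by
        rw [abs_le]
        constructor <;> linarith [(hgab x).1, (hgab x).2]
      have h2 : |F x ^ 2 - N| ≤ B ^ 2 + N := by
        have := abs_sub (F x ^ 2) N
        rw [abs_of_nonneg hN0] at this
        linarith [abs_sq_le_of_abs_le (hB x)]
      exact mul_le_mul h1 h2 (abs_nonneg _) (by linarith)
  have iabs : Integrable (fun x => |F x + √N| * |F x + -√N|) μ :=
    integrable_of_abs_le ((hF.add_const _).abs.mul (hF.add_const _).abs)
      (M := (B + |√N|) * (B + |-√N|)) fun x => by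
      rw [abs_mul, abs_abs, abs_abs]
      exact mul_le_mul (bd _ x) (bd _ x) (abs_nonneg _) ((abs_nonneg _).trans (bd _ x))
  rw [e1]
  calc _ ≤ ∫ x, (b - a) / 2 * (|F x + √N| * |F x + -√N|) ∂μ :=
        integral_mono imid (iabs.const_mul _) hpt
    _ ≤ (b - a) / 2 * (2 * (√N * √(N - c ^ 2))) := by
        rw [integral_const_mul]
        gcongr
    _ = _ := by ring

variable {E : Type*} [MeasurableSpace E] {P : ℝ≥0 → Kernel E E} {q : E → ℝ≥0} {J : Kernel E E}
  {π : Measure E} [IsProbabilityMeasure π] {l : ℝ}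

/-- The variance of `P_t f` decays: `Var f ≥ e^{2lt} Var (P_t f)`, linearised. -/
theorem IsConservativeQPair.integral_act_sq_add_le (hP : IsJumpTransitionFunction P)
    (hq : IsConservativeQPair P q J) {C : ℝ≥0} (hC : ∀ x, q x ≤ C)
    (hπ : ∀ t, Kernel.Invariant (P t) π) (hl : (l : EReal) ≤ spectralGap P π)
    {f : E → ℝ} (hf : Measurable f) {M : ℝ} (hM : ∀ x, |f x| ≤ M) (t : ℝ≥0) :
    0 ≤ ∫ x, act P t f x ^ 2 ∂π - (∫ x, act P t f x ∂π) ^ 2 ∧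
    ∫ x, act P t f x ^ 2 ∂π +
      2 * l * t * (∫ x, act P t f x ^ 2 ∂π - (∫ x, act P t f x ∂π) ^ 2) ≤ ∫ x, f x ^ 2 ∂π := by
  have := hP.markov t
  have hM' : ∀ x, |act P t f x| ≤ M := hP.abs_act_le t hM
  have hm : Measurable (act P t f) := measurable_act t hf
  have hinv := integral_act (hπ t) hf hM
  rw [hinv]
  set c := ∫ x, f x ∂π with hc
  have bd : ∀ x, |f x - c| ≤ M + |c| := fun x => (abs_sub _ _).trans (by linarith [hM x])
  have h0 : ∫ x, (f x - c) ∂π = 0 := by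
    rw [integral_sub (integrable_of_abs_le hf hM) (integrable_const _)]
    simp [hc]
  have h := hq.integral_act_sq_le hP hC hπ hl (hf.sub_const c) bd h0 t
  have e1 : ∀ x, act P t (fun x => f x - c) x = act P t f x - c := fun x => by
    simp only [act]
    rw [integral_sub (integrable_of_abs_le hf hM) (integrable_const _)]
    simp
  have e2 : ∀ u : E → ℝ, Measurable u → (∀ x, |u x| ≤ M) → ∫ x, u x ∂π = c →
      ∫ x, (u x - c) ^ 2 ∂π = ∫ x, u x ^ 2 ∂π - c ^ 2 := fun u hu hu' huc => by
    have : ∀ x, (u x - c) ^ 2 = u x ^ 2 - 2 * c * u x + c ^ 2 := fun x => by ring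
    have i1 := integrable_of_abs_le (μ := π) hu hu'
    have i2 := integrable_of_abs_le (μ := π) (hu.pow_const 2) (M := M ^ 2)
      fun x => abs_sq_le_of_abs_le (hu' x)
    simp_rw [this]
    have i3 : Integrable (fun x => u x ^ 2 - 2 * c * u x) π := i2.sub (i1.const_mul _)
    rw [integral_add i3 (integrable_const _),
      integral_sub i2 (i1.const_mul _), integral_const_mul, huc]
    simp; ring
  simp_rw [e1] at h
  rw [e2 _ hm hM' hinv, e2 _ hf hM rfl] at h
  have hV : 0 ≤ ∫ x, act P t f x ^ 2 ∂π - c ^ 2 := by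
    rw [← e2 _ hm hM' hinv]; exact integral_nonneg fun x => sq_nonneg _
  refine ⟨hV, ?_⟩
  have hexp : (1 + 2 * l * t) * Real.exp (-2 * l * t) ≤ 1 := by
    have h1 := Real.add_one_le_exp (2 * l * t)
    calc _ ≤ Real.exp (2 * l * t) * Real.exp (-2 * l * t) := by gcongr; linarith
      _ = 1 := by rw [← Real.exp_add]; simp
  have hF : 0 ≤ ∫ x, f x ^ 2 ∂π - c ^ 2 := by
    rw [← e2 _ hf hM rfl]; exact integral_nonneg fun x => sq_nonneg _
  have h2 : (1 + 2 * l * t) * (∫ x, act P t f x ^ 2 ∂π - c ^ 2) ≤ ∫ x, f x ^ 2 ∂π - c ^ 2 := by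
    -- The sign of l is not fixed here; if the factor is nonpositive, so is the left side.
    rcases le_total 0 (1 + 2 * l * t) with h3 | h3
    · calc _ ≤ (1 + 2 * l * t) * (Real.exp (-2 * l * t) * (∫ x, f x ^ 2 ∂π - c ^ 2)) := by gcongr
        _ = ((1 + 2 * l * t) * Real.exp (-2 * l * t)) * (∫ x, f x ^ 2 ∂π - c ^ 2) := by ring
        _ ≤ 1 * (∫ x, f x ^ 2 ∂π - c ^ 2) := by gcongr
        _ = _ := one_mul _
    · exact (mul_nonpos_of_nonpos_of_nonneg h3 hV).trans hF
  linarith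

/-- The transition operator tilted by `φ`. -/
noncomputable def tilt (P : ℝ≥0 → Kernel E E) (h : ℝ≥0) (φ f : E → ℝ) (x : E) : ℝ :=
  φ x * act P h f x

/-- One step of the tilted semigroup in `L²(π)`. -/
theorem IsConservativeQPair.integral_tilt_sq_le (hP : IsJumpTransitionFunction P)
    (hq : IsConservativeQPair P q J) {C : ℝ≥0} (hC : ∀ x, q x ≤ C)
    (hπ : ∀ t, Kernel.Invariant (P t) π) (hl0 : 0 < l) (hl : (l : EReal) ≤ spectralGap P π)
    {g : E → ℝ} (hg : Measurable g) {a b : ℝ} (hab : a ≤ b) (hgab : ∀ x, g x ∈ Set.Icc a b)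
    {θ : ℝ} (hθ : 0 ≤ θ) {h : ℝ≥0} (hh : 2 * θ * h * (b - a) ≤ 1)
    {f : E → ℝ} (hf : Measurable f) {M : ℝ} (hM : ∀ x, |f x| ≤ M) :
    ∫ x, tilt P h (fun x => Real.exp (θ * h * (g x - ∫ y, g y ∂π))) f x ^ 2 ∂π ≤
      (1 + 2 * h * (θ ^ 2 * (b - a) ^ 2 / (4 * l)) + 4 * θ ^ 2 * (b - a) ^ 2 * h ^ 2) *
        ∫ x, f x ^ 2 ∂π := by
  have hM' : ∀ x, |act P h f x| ≤ M := hP.abs_act_le h hM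
  have hm : Measurable (act P h f) := measurable_act h hf
  obtain ⟨hV, hdec⟩ := hq.integral_act_sq_add_le hP hC hπ hl hf hM h
  have hLC := integral_sub_mul_sq_le (μ := π) hg hm hab hgab hM'
  set F := act P h f with hFdef
  set N := ∫ x, F x ^ 2 ∂π with hN
  set V := N - (∫ x, F x ∂π) ^ 2 with hVdef
  set m := ∫ y, g y ∂π with hmdef
  set D := b - a with hD
  have hD0 : 0 ≤ D := sub_nonneg.2 hab
  have hN0 : 0 ≤ N := integral_nonneg fun x => sq_nonneg _
  have hgB : ∀ x, |g x| ≤ |a| + |b| := fun x => by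
    rw [abs_le]
    constructor <;> linarith [(hgab x).1, (hgab x).2, neg_abs_le a, le_abs_self b, abs_nonneg a,
      abs_nonneg b]
  have ig : Integrable g π := integrable_of_abs_le hg hgB
  have hma : a ≤ m := by simpa using integral_mono (integrable_const a) ig fun x => (hgab x).1
  have hmb : m ≤ b := by simpa using integral_mono ig (integrable_const b) fun x => (hgab x).2
  have hgm : ∀ x, |g x - m| ≤ D := fun x => by
    rw [abs_le]
    constructor <;> linarith [(hgab x).1, (hgab x).2]
  have hpt : ∀ x, tilt P h (fun x => Real.exp (θ * h * (g x - m))) f x ^ 2 ≤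
      (1 + 4 * θ ^ 2 * D ^ 2 * h ^ 2) * F x ^ 2 + 2 * θ * h * ((g x - m) * F x ^ 2) := fun x => by
    rw [tilt, mul_pow, ← Real.exp_nat_mul]
    set y := 2 * θ * h * (g x - m) with hy
    have hy1 : |y| ≤ 2 * θ * h * D := by
      rw [hy, abs_mul, abs_of_nonneg (by positivity)]
      gcongr; exact hgm x
    -- The smallness of h is used here: |e^y - 1 - y| ≤ y² requires |y| ≤ 1.
    have h1 := (abs_le.1 (Real.abs_exp_sub_one_sub_id_le (hy1.trans hh))).2
    have h2 : y ^ 2 ≤ (2 * θ * h * D) ^ 2 := sq_le_sq' (by linarith [(abs_le.1 hy1).1])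
      (le_of_abs_le hy1)
    have e : ((2 : ℕ) : ℝ) * (θ * h * (g x - m)) = y := by rw [hy]; push_cast; ring
    rw [e]
    have h3 : Real.exp y ≤ 1 + y + (2 * θ * h * D) ^ 2 := by linarith
    have := mul_le_mul_of_nonneg_right h3 (sq_nonneg (F x))
    refine this.trans (le_of_eq ?_)
    rw [hy]; ring
  have iF2 : Integrable (fun x => F x ^ 2) π :=
    integrable_of_abs_le (hm.pow_const 2) (M := M ^ 2) fun x => abs_sq_le_of_abs_le (hM' x)
  have igF : Integrable (fun x => (g x - m) * F x ^ 2) π :=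
    integrable_of_abs_le ((hg.sub_const m).mul (hm.pow_const 2)) (M := D * M ^ 2) fun x => by
      rw [abs_mul]
      exact mul_le_mul (hgm x) (abs_sq_le_of_abs_le (hM' x)) (abs_nonneg _) hD0
  have hint : ∫ x, tilt P h (fun x => Real.exp (θ * h * (g x - m))) f x ^ 2 ∂π ≤
      (1 + 4 * θ ^ 2 * D ^ 2 * h ^ 2) * N + 2 * θ * h * ∫ x, (g x - m) * F x ^ 2 ∂π := by
    rw [hN, ← integral_const_mul, ← integral_const_mul,
      ← integral_add (iF2.const_mul _) (igF.const_mul _)]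
    exact integral_mono_of_nonneg (ae_of_all _ fun x => sq_nonneg _)
      ((iF2.const_mul _).add (igF.const_mul _)) (ae_of_all _ hpt)
  -- The weights make the variance coefficient exactly l, matching the gain 2lhV in `hdec`.
  have hamgm : θ * (D * (√N * √V)) ≤ l * V + θ ^ 2 * D ^ 2 / (4 * l) * N := by
    have h1 : 0 ≤ (l * √V - θ * D / 2 * √N) ^ 2 / l := by positivity
    have e : (l * √V - θ * D / 2 * √N) ^ 2 / l =
        l * √V ^ 2 + θ ^ 2 * D ^ 2 / (4 * l) * √N ^ 2 - θ * (D * (√N * √V)) := by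
      field_simp; ring
    rw [e, Real.sq_sqrt hN0, Real.sq_sqrt hV] at h1
    linarith
  have hNf : N ≤ ∫ x, f x ^ 2 ∂π := by
    have : 0 ≤ 2 * l * h * V := by positivity
    linarith
  have h1 : 2 * θ * h * ∫ x, (g x - m) * F x ^ 2 ∂π ≤
      2 * h * (l * V + θ ^ 2 * D ^ 2 / (4 * l) * N) := by
    have h2 := mul_le_mul_of_nonneg_left hLC hθ
    have h3 := mul_le_mul_of_nonneg_left (h2.trans hamgm) (by positivity : (0 : ℝ) ≤ 2 * h)
    linarith
  have h4 : (2 * h * (θ ^ 2 * D ^ 2 / (4 * l)) + 4 * θ ^ 2 * D ^ 2 * h ^ 2) * N ≤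
      (2 * h * (θ ^ 2 * D ^ 2 / (4 * l)) + 4 * θ ^ 2 * D ^ 2 * h ^ 2) * ∫ x, f x ^ 2 ∂π := by
    gcongr
  linarith

end JumpProcess

/-! ### Powers of the tilted operator -/

namespace JumpProcess

section Tilt

variable {E : Type*} [MeasurableSpace E] {P : ℝ≥0 → Kernel E E} {h : ℝ≥0} {φ f : E → ℝ} {K M : ℝ}

theorem measurable_tilt (hφ : Measurable φ) (hf : Measurable f) : Measurable (tilt P h φ f) :=
  hφ.mul (measurable_act h hf)

theorem IsJumpTransitionFunction.abs_tilt_le (hP : IsJumpTransitionFunction P)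
    (hK : ∀ x, |φ x| ≤ K) (hM : ∀ x, |f x| ≤ M) (x : E) : |tilt P h φ f x| ≤ K * M := by
  rw [tilt, abs_mul]
  exact mul_le_mul (hK x) (hP.abs_act_le h hM x) (abs_nonneg _) ((abs_nonneg _).trans (hK x))

theorem tilt_nonneg (hφ : ∀ x, 0 ≤ φ x) (hf : ∀ x, 0 ≤ f x) (x : E) : 0 ≤ tilt P h φ f x :=
  mul_nonneg (hφ x) (integral_nonneg hf)

theorem IsJumpTransitionFunction.integral_iterate_tilt_sq_le (hP : IsJumpTransitionFunction P)
    {π : Measure E} (hφ : Measurable φ) (hK : ∀ x, |φ x| ≤ K) {ρ : ℝ} (hρ : 0 ≤ ρ)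
    (hstep : ∀ (f : E → ℝ) (M : ℝ), Measurable f → (∀ x, |f x| ≤ M) →
      ∫ x, tilt P h φ f x ^ 2 ∂π ≤ ρ * ∫ x, f x ^ 2 ∂π)
    (k : ℕ) (hf : Measurable f) (hM : ∀ x, |f x| ≤ M) :
    ∫ x, (tilt P h φ)^[k] f x ^ 2 ∂π ≤ ρ ^ k * ∫ x, f x ^ 2 ∂π := by
  induction k generalizing f M with
  | zero => simp
  | succ k ih =>
    rw [Function.iterate_succ_apply]
    calc _ ≤ ρ ^ k * ∫ x, tilt P h φ f x ^ 2 ∂π := ih (measurable_tilt hφ hf) (hP.abs_tilt_le hK hM)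
      _ ≤ ρ ^ k * (ρ * ∫ x, f x ^ 2 ∂π) := by gcongr; exact hstep f M hf hM
      _ = _ := by ring

theorem IsJumpTransitionFunction.exists_bound_iterate_tilt (hP : IsJumpTransitionFunction P)
    (hφ : Measurable φ) (hK : ∀ x, |φ x| ≤ K) (k : ℕ) (hf : Measurable f) (hM : ∀ x, |f x| ≤ M) :
    Measurable ((tilt P h φ)^[k] f) ∧ ∃ B, ∀ x, |(tilt P h φ)^[k] f x| ≤ B := by
  induction k generalizing f M with
  | zero => exact ⟨hf, M, hM⟩
  | succ k ih =>
    rw [Function.iterate_succ_apply]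
    exact ih (measurable_tilt hφ hf) (hP.abs_tilt_le hK hM)

/-- `∫ T^k 1 dπ ≤ ‖T^k 1‖` for the tilted operator. -/
theorem IsJumpTransitionFunction.integral_iterate_tilt_one_le (hP : IsJumpTransitionFunction P)
    {π : Measure E} [IsProbabilityMeasure π] (hφ : Measurable φ) (hK : ∀ x, |φ x| ≤ K) {r : ℝ}
    (hstep : ∀ (f : E → ℝ) (M : ℝ), Measurable f → (∀ x, |f x| ≤ M) →
      ∫ x, tilt P h φ f x ^ 2 ∂π ≤ Real.exp (2 * r) * ∫ x, f x ^ 2 ∂π) (k : ℕ) :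
    ∫ x, (tilt P h φ)^[k] (fun _ => 1) x ∂π ≤ Real.exp (k * r) := by
  have h1 : ∀ x : E, |(fun _ : E => (1 : ℝ)) x| ≤ 1 := fun x => by simp
  have hsq := hP.integral_iterate_tilt_sq_le hφ hK (Real.exp_pos _).le hstep k measurable_const h1
  obtain ⟨hm, B, hB⟩ := hP.exists_bound_iterate_tilt (h := h) hφ hK k measurable_const h1
  set u := (tilt P h φ)^[k] (fun _ => 1)
  have hcs := integral_abs_mul_abs_le (μ := π) hm measurable_const hB h1
  simp only [abs_one, mul_one, one_pow, integral_const, probReal_univ, smul_eq_mul,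
    Real.sqrt_one] at hcs hsq
  have e : Real.exp (2 * r) ^ k = Real.exp (k * r) ^ 2 := by
    rw [← Real.exp_nat_mul, ← Real.exp_nat_mul]; congr 1; push_cast; ring
  calc ∫ x, u x ∂π ≤ ∫ x, |u x| ∂π :=
        integral_mono (integrable_of_abs_le hm hB) (integrable_of_abs_le hm hB).abs
          fun x => le_abs_self _
    _ ≤ _ := hcs
    _ ≤ √(Real.exp (k * r) ^ 2) := Real.sqrt_le_sqrt (hsq.trans e.le)
    _ = _ := Real.sqrt_sq (Real.exp_pos _).le

end Tilt

/-! ### Multiplicative functionals of the skeleton chain -/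

section Markov

variable {E : Type*} [TopologicalSpace E] [MeasurableSpace E] {P : ℝ≥0 → Kernel E E}
  {π : Measure E} {Ω : Type*} [MeasurableSpace Ω] {Pr : Measure Ω}
  {X : ℝ≥0 → Ω → E}

theorem IsMarkovProcess.past_le (hX : IsMarkovProcess Pr X P π) (s : ℝ≥0) :
    past X s ≤ ‹MeasurableSpace Ω› :=
  iSup_le fun u => iSup_le fun _ => (hX.measurable u).comap_le

theorem measurable_past {E Ω : Type*} [MeasurableSpace E] (X : ℝ≥0 → Ω → E) {u s : ℝ≥0} (hus : u ≤ s) :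
    Measurable[past X s] (X u) :=
  Measurable.mono (comap_measurable (X u)) (le_iSup₂_of_le u hus le_rfl) le_rfl

theorem IsMarkovProcess.measure_inter_preimage [IsProbabilityMeasure Pr]
    (hP : IsJumpTransitionFunction P) (hX : IsMarkovProcess Pr X P π) (s t : ℝ≥0) {S : Set Ω} (hS : MeasurableSet[past X s] S)
    {A : Set E} (hA : MeasurableSet A) :
    Pr (S ∩ X (s + t) ⁻¹' A) = ∫⁻ ω in S, P t (X s ω) A ∂Pr := by
  have := hP.markov t
  have hS' : MeasurableSet S := hX.past_le s S hS
  have hA' : MeasurableSet (X (s + t) ⁻¹' A) := hX.measurable _ hA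
  have h1 := setIntegral_condExp (μ := Pr) (f := (X (s + t) ⁻¹' A).indicator fun _ => (1 : ℝ))
    (hX.past_le s) ((integrable_const _).indicator hA') hS
  rw [setIntegral_congr_ae hS' ((hX.markov_property s t A hA).mono fun ω h _ => h)] at h1
  have hm : Measurable fun ω => (P t (X s ω)).real A :=
    (((P t).measurable_coe hA).comp (hX.measurable s)).ennreal_toReal
  have h2 := ofReal_integral_eq_lintegral_ofReal (μ := Pr.restrict S)
    (integrable_of_abs_le hm (M := 1) fun ω => by
      rw [abs_of_nonneg measureReal_nonneg]; exact measureReal_le_one)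
    (ae_of_all _ fun ω => measureReal_nonneg)
  simp only [ofReal_measureReal (measure_ne_top _ _)] at h2
  rw [← h2, h1, integral_indicator hA']
  simp [measureReal_restrict_apply, hA', Set.inter_comm]

theorem IsMarkovProcess.setLIntegral_comp [IsProbabilityMeasure Pr]
    (hP : IsJumpTransitionFunction P) (hX : IsMarkovProcess Pr X P π) (s t : ℝ≥0) {S : Set Ω} (hS : MeasurableSet[past X s] S)
    {f : E → ℝ≥0∞} (hf : Measurable f) :
    ∫⁻ ω in S, f (X (s + t) ω) ∂Pr = ∫⁻ ω in S, ∫⁻ y, f y ∂(P t (X s ω)) ∂Pr := by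
  have hμ : (Pr.restrict S).map (X (s + t)) = ((Pr.restrict S).map (X s)).bind (P t) := by
    ext A hA
    rw [Measure.map_apply (hX.measurable _) hA, Measure.bind_apply hA (P t).aemeasurable,
      lintegral_map ((P t).measurable_coe hA) (hX.measurable s),
      Measure.restrict_apply (hX.measurable _ hA), Set.inter_comm,
      hX.measure_inter_preimage hP s t hS hA]
  rw [← lintegral_map hf (hX.measurable (s + t)), hμ,
    Measure.lintegral_bind (P t).aemeasurable hf.aemeasurable,
    lintegral_map hf.lintegral_kernel (hX.measurable s)]

/-- The Markov property for a weight Z from the past, extended from indicators by linearity and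
monotone limits; `lintegral` avoids integrability conditions. -/
theorem IsMarkovProcess.lintegral_mul_comp [IsProbabilityMeasure Pr]
    (hP : IsJumpTransitionFunction P) (hX : IsMarkovProcess Pr X P π) (s t : ℝ≥0) {Z : Ω → ℝ≥0∞} (hZ : Measurable[past X s] Z)
    {f : E → ℝ≥0∞} (hf : Measurable f) :
    ∫⁻ ω, Z ω * f (X (s + t) ω) ∂Pr = ∫⁻ ω, Z ω * ∫⁻ y, f y ∂(P t (X s ω)) ∂Pr := by
  have hle := hX.past_le s
  have hm1 : Measurable fun ω => f (X (s + t) ω) := hf.comp (hX.measurable _)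
  have hm2 : Measurable fun ω => ∫⁻ y, f y ∂(P t (X s ω)) :=
    (hf.lintegral_kernel (κ := P t)).comp (hX.measurable s)
  have hmul : ∀ Z F : Ω → ℝ≥0∞, Measurable[past X s] Z → Measurable F →
      Measurable fun ω => Z ω * F ω := fun Z F hZ hF => (hZ.mono hle le_rfl).mul hF
  refine @Measurable.ennreal_induction Ω (past X s)
    (fun Z => ∫⁻ ω, Z ω * f (X (s + t) ω) ∂Pr = ∫⁻ ω, Z ω * ∫⁻ y, f y ∂(P t (X s ω)) ∂Pr)
    (fun c S hS => ?_) (fun Z₁ Z₂ _ h₁ h₂ ih₁ ih₂ => ?_) (fun Z hZ hmono ih => ?_) Z hZ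
  · have e : ∀ F : Ω → ℝ≥0∞, Measurable F →
        ∫⁻ ω, S.indicator (fun _ => c) ω * F ω ∂Pr = c * ∫⁻ ω in S, F ω ∂Pr := fun F hF => by
      rw [← lintegral_const_mul _ hF, ← lintegral_indicator (hle S hS)]
      congr 1; ext ω
      by_cases hω : ω ∈ S <;> simp [hω]
    rw [e _ hm1, e _ hm2, hX.setLIntegral_comp hP s t hS hf]
  · simp only [Pi.add_apply, add_mul]
    rw [lintegral_add_left (hmul _ _ h₁ hm1), ih₁, ih₂,
      lintegral_add_left (hmul _ _ h₁ hm2)]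
  · simp only [ENNReal.iSup_mul]
    rw [lintegral_iSup (fun n => hmul _ _ (hZ n) hm1)
        (fun i j hij ω => mul_le_mul_left (hmono hij ω) _),
      lintegral_iSup (fun n => hmul _ _ (hZ n) hm2)
        (fun i j hij ω => mul_le_mul_left (hmono hij ω) _)]
    simp_rw [ih]

theorem lintegral_ofReal_kernel {E : Type*} [MeasurableSpace E] {P : ℝ≥0 → Kernel E E}
    (hP : IsJumpTransitionFunction P) (h : ℝ≥0) {f : E → ℝ} {M : ℝ}
    (hf : Measurable f) (hf0 : ∀ x, 0 ≤ f x) (hM : ∀ x, |f x| ≤ M) (x : E) :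
    ∫⁻ y, ENNReal.ofReal (f y) ∂(P h x) = ENNReal.ofReal (act P h f x) := by
  have := hP.markov h
  exact (ofReal_integral_eq_lintegral_ofReal (integrable_of_abs_le hf hM) (ae_of_all _ hf0)).symm

/-- Multiplicative functionals along the skeleton of the process are given by powers of the tilted
transition operator. -/
theorem IsMarkovProcess.lintegral_prod_mul [IsProbabilityMeasure Pr]
    (hP : IsJumpTransitionFunction P) [IsProbabilityMeasure π] (hπ : ∀ t, Kernel.Invariant (P t) π) (hX : IsMarkovProcess Pr X P π)
    (h : ℝ≥0) {φ f : E → ℝ} {K M : ℝ} (hφ : Measurable φ) (hφ0 : ∀ x, 0 ≤ φ x)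
    (hK : ∀ x, |φ x| ≤ K) (hf : Measurable f) (hf0 : ∀ x, 0 ≤ f x) (hM : ∀ x, |f x| ≤ M) (k : ℕ) :
    ∫⁻ ω, (∏ i ∈ Finset.range k, ENNReal.ofReal (φ (X ((i + 1 : ℕ) * h) ω))) *
        ENNReal.ofReal (f (X ((k + 1 : ℕ) * h) ω)) ∂Pr =
      ENNReal.ofReal (∫ x, (tilt P h φ)^[k] f x ∂π) := by
  induction k generalizing f M with
  | zero =>
    -- The skeleton starts at time h, not 0; invariance removes the extra P_h.
    have := hP.markov h
    have e := hX.lintegral_mul_comp hP 0 h (Z := fun _ => 1) measurable_const hf.ennreal_ofReal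
    simp only [lintegral_ofReal_kernel hP h hf hf0 hM, one_mul, zero_add] at e
    have hm := measurable_act (P := P) h hf
    simp only [Finset.range_zero, Finset.prod_empty, one_mul, zero_add, Nat.cast_one,
      Function.iterate_zero, id]
    rw [e, ← lintegral_map (f := fun x => ENNReal.ofReal (act P h f x)) hm.ennreal_ofReal
      (hX.measurable 0), hX.initial, ← integral_act (hπ h) hf hM,
      ofReal_integral_eq_lintegral_ofReal (integrable_of_abs_le hm (hP.abs_act_le h hM))
        (ae_of_all _ fun x => integral_nonneg hf0)]
  | succ k ih =>
    have hZ : Measurable[past X ((k + 1 : ℕ) * h)] fun ω =>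
        ∏ i ∈ Finset.range (k + 1), ENNReal.ofReal (φ (X ((i + 1 : ℕ) * h) ω)) := by
      refine Finset.measurable_prod _ fun i hi => ?_
      refine hφ.ennreal_ofReal.comp (measurable_past X ?_)
      have : i + 1 ≤ k + 1 := Finset.mem_range.1 hi
      gcongr
    -- Conditioning at the last time but one replaces f by P_h f, which merges with the last factor
    -- φ into the tilted function.
    have e := hX.lintegral_mul_comp hP ((k + 1 : ℕ) * h) h hZ hf.ennreal_ofReal
    have e2 : ((k + 1 : ℕ) : ℝ≥0) * h + h = (k + 1 + 1 : ℕ) * h := by push_cast; ring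
    rw [e2] at e
    rw [e, Function.iterate_succ_apply, ← ih (measurable_tilt hφ hf) (tilt_nonneg hφ0 hf0)
      (hP.abs_tilt_le hK hM)]
    refine lintegral_congr fun ω => ?_
    rw [lintegral_ofReal_kernel hP h hf hf0 hM, Finset.prod_range_succ, tilt,
      ENNReal.ofReal_mul (hφ0 _), mul_assoc]

end Markov

end JumpProcess

/-! ### Riemann sums of right-continuous paths -/

namespace JumpProcess

/-- Right-endpoint Riemann sums of a bounded right-continuous function converge to its integral. -/
theorem tendsto_riemannSum_of_rightContinuous {v : ℝ≥0 → ℝ} {M : ℝ} (hM : ∀ s, |v s| ≤ M)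
    (hv : ∀ s, ContinuousWithinAt v (Set.Ici s) s) {t : ℝ≥0} (ht : 0 < t) :
    Tendsto (fun n : ℕ => ∑ i ∈ Finset.range (n + 1),
        ((t / (n + 1 : ℕ) : ℝ≥0) : ℝ) * v ((i + 1 : ℕ) * (t / (n + 1 : ℕ)))) atTop
      (𝓝 (∫ s in (0 : ℝ)..t, v s.toNNReal)) := by
  set h : ℕ → ℝ≥0 := fun n => t / (n + 1 : ℕ) with hh
  have hpos : ∀ n, 0 < h n := fun n => by simp only [hh]; positivity
  have hpos' : ∀ n, (0 : ℝ) < h n := fun n => hpos n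
  -- Sampling at the first grid point not before s approaches s from the right, so right-continuity
  -- suffices.
  set F : ℕ → ℝ → ℝ := fun n s => v (⌈s / h n⌉₊ * h n) with hF
  have hFm : ∀ n, Measurable (F n) := fun n =>
    (measurable_from_top (f := fun k : ℕ => v (k * h n))).comp
      (Nat.measurable_ceil.comp (measurable_id.div_const _))
  have hint : ∀ n a b, IntervalIntegrable (F n) volume a b := fun n a b =>
    (intervalIntegrable_const (c := M)).mono_fun (hFm n).aestronglyMeasurable
      (ae_of_all _ fun s => by
        simpa only [Real.norm_eq_abs] using (hM _).trans (le_abs_self M))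
  have hsum : ∀ n, ∑ i ∈ Finset.range (n + 1), (h n : ℝ) * v ((i + 1 : ℕ) * h n) =
      ∫ s in (0 : ℝ)..t, F n s := fun n => by
    have e := intervalIntegral.sum_integral_adjacent_intervals (f := F n) (μ := volume)
      (a := fun i : ℕ => (i : ℝ) * h n) (n := n + 1) fun k _ => hint n _ _
    have e0 : ((n + 1 : ℕ) : ℝ) * h n = t := by
      simp only [hh]; push_cast; field_simp
    simp only [e0, Nat.cast_zero, zero_mul] at e
    rw [← e]
    refine Finset.sum_congr rfl fun i _ => ?_
    have hle : (i : ℝ) * h n ≤ ((i + 1 : ℕ) : ℝ) * h n := by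
      push_cast; nlinarith [hpos' n]
    have e1 : ∫ s in (i : ℝ) * h n..((i + 1 : ℕ) : ℝ) * h n, F n s =
        ∫ s in (i : ℝ) * h n..((i + 1 : ℕ) : ℝ) * h n, v ((i + 1 : ℕ) * h n) := by
      rw [intervalIntegral.integral_of_le hle, intervalIntegral.integral_of_le hle]
      refine setIntegral_congr_fun measurableSet_Ioc fun s hs => ?_
      have : ⌈s / h n⌉₊ = i + 1 := by
        rw [Nat.ceil_eq_iff (by omega)]
        exact ⟨(lt_div_iff₀ (hpos' n)).2 (by simpa using hs.1), (div_le_iff₀ (hpos' n)).2 hs.2⟩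
      simp only [hF, this]
    rw [e1, intervalIntegral.integral_const, smul_eq_mul]
    push_cast; ring
  refine Tendsto.congr (fun n => (hsum n).symm) ?_
  refine intervalIntegral.tendsto_integral_filter_of_dominated_convergence (fun _ => M)
    (Eventually.of_forall fun n => (hFm n).aestronglyMeasurable)
    (Eventually.of_forall fun n => ae_of_all _ fun s _ => hM _) intervalIntegrable_const
    (ae_of_all _ fun s hs => ?_)
  rw [Set.uIoc_of_le t.coe_nonneg] at hs
  refine (hv s.toNNReal).tendsto.comp (tendsto_nhdsWithin_iff.2
    ⟨?_, Eventually.of_forall fun n => ?_⟩)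
  · rw [← NNReal.tendsto_coe, Real.coe_toNNReal _ hs.1.le]
    have h0 : Tendsto (fun n => s + (h n : ℝ)) atTop (𝓝 s) := by
      have : Tendsto (fun n : ℕ => (h n : ℝ)) atTop (𝓝 0) := by
        simpa [hh, div_eq_mul_inv] using
          (tendsto_one_div_add_atTop_nhds_zero_nat (𝕜 := ℝ)).const_mul (t : ℝ)
      simpa using this.const_add s
    refine tendsto_of_tendsto_of_tendsto_of_le_of_le tendsto_const_nhds h0 (fun n => ?_) fun n => ?_
    · have := Nat.le_ceil (s / (h n : ℝ))
      rw [div_le_iff₀ (hpos' n)] at this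
      simpa using this
    · have h1 := Nat.ceil_lt_add_one (div_nonneg hs.1.le (hpos' n).le)
      have h2 := mul_lt_mul_of_pos_right h1 (hpos' n)
      rw [add_mul, div_mul_cancel₀ _ (hpos' n).ne', one_mul] at h2
      simpa using h2.le
  · rw [Set.mem_Ici, Real.toNNReal_le_iff_le_coe]
    have := Nat.le_ceil (s / (h n : ℝ))
    rw [div_le_iff₀ (hpos' n)] at this
    simpa using this

end JumpProcess

/-! ### The Chernoff argument -/

namespace JumpProcess

/-- The deviation bound for a real lower bound `l` of the spectral gap. -/
theorem IsMarkovProcess.measure_deviation_le {E : Type*} [TopologicalSpace E] [MeasurableSpace E]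
    [OpensMeasurableSpace E] {Ω : Type*} [MeasurableSpace Ω] {Pr : Measure Ω}
    [IsProbabilityMeasure Pr] {P : ℝ≥0 → Kernel E E} (hP : IsJumpTransitionFunction P)
    {π : Measure E} [IsProbabilityMeasure π] (hπ : ∀ t, Kernel.Invariant (P t) π)
    {X : ℝ≥0 → Ω → E} (hX : IsMarkovProcess Pr X P π)
    {q : E → ℝ≥0} {J : Kernel E E} (hq : IsConservativeQPair P q J) {C : ℝ≥0}
    (hC : ∀ x, q x ≤ C) {l : ℝ} (hl0 : 0 < l) (hl : (l : EReal) ≤ spectralGap P π)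
    {a b : ℝ} (hab : a < b) {g : E → ℝ} (hg : Continuous g) (hgab : ∀ x, g x ∈ Set.Icc a b)
    {t ε : ℝ} (ht : 0 < t) (hε : 0 < ε) :
    Pr {ω | ε ≤ (1 / t) * (∫ s in (0 : ℝ)..t, g (X s.toNNReal ω)) - ∫ x, g x ∂π} ≤
      ENNReal.ofReal (Real.exp (-(l * (t * ε ^ 2 / (b - a) ^ 2)))) := by
  have hgm : Measurable g := hg.measurable
  set m := ∫ x, g x ∂π with hm
  set D := b - a with hD
  have hD0 : 0 < D := sub_pos.2 hab
  lift t to ℝ≥0 using ht.le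
  have ht' : 0 < t := by exact_mod_cast ht
  -- Minimiser of θ²D²/(4l) - θε, with minimum -lε²/D².
  set θ := 2 * l * ε / D ^ 2 with hθ
  have hθ0 : 0 < θ := by positivity
  set K := θ ^ 2 * D ^ 2 / (4 * l) with hK
  set h : ℕ → ℝ≥0 := fun n => t / (n + 1 : ℕ) with hh
  have hnh : ∀ n, ((n + 1 : ℕ) : ℝ) * h n = t := fun n => by
    simp only [hh]; push_cast; field_simp
  have hh0 : Tendsto (fun n => (h n : ℝ)) atTop (𝓝 0) := by
    simpa [hh, div_eq_mul_inv] using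
      (tendsto_one_div_add_atTop_nhds_zero_nat (𝕜 := ℝ)).const_mul (t : ℝ)
  have hgB : ∀ x, |g x| ≤ |a| + |b| := fun x => by
    rw [abs_le]
    constructor <;> linarith [(hgab x).1, (hgab x).2, neg_abs_le a, le_abs_self b, abs_nonneg a,
      abs_nonneg b]
  set φ : ℕ → E → ℝ := fun n x => Real.exp (θ * h n * (g x - m)) with hφ
  have hφm : ∀ n, Measurable (φ n) := fun n => ((hgm.sub_const m).const_mul _).exp
  have hφB : ∀ n x, |φ n x| ≤ Real.exp (θ * h n * (|a| + |b| - m)) := fun n x => by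
    rw [abs_of_pos (Real.exp_pos _)]
    refine Real.exp_le_exp.2 ?_
    gcongr
    exact (le_abs_self _).trans (hgB x)
  set Y : ℕ → Ω → ℝ≥0∞ := fun n ω =>
    ∏ i ∈ Finset.range (n + 1), ENNReal.ofReal (φ n (X ((i + 1 : ℕ) * h n) ω)) with hY
  have hYm : ∀ n, Measurable (Y n) := fun n =>
    Finset.measurable_prod _ fun i _ => ((hφm n).comp (hX.measurable _)).ennreal_ofReal
  have hYe : ∀ n ω, Y n ω = ENNReal.ofReal (Real.exp (θ *
      (∑ i ∈ Finset.range (n + 1), (h n : ℝ) * g (X ((i + 1 : ℕ) * h n) ω) - t * m))) := by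
    intro n ω
    simp only [hY, hφ]
    rw [← ENNReal.ofReal_prod_of_nonneg fun i _ => (Real.exp_pos _).le, ← Real.exp_sum,
      ← Finset.mul_sum, Finset.sum_sub_distrib, ← Finset.mul_sum]
    simp only [Finset.sum_const, Finset.card_range, nsmul_eq_mul]
    rw [← hnh n]
    congr 2
    ring
  have hYlim : ∀ᵐ ω ∂Pr, liminf (fun n => Y n ω) atTop = ENNReal.ofReal (Real.exp (θ *
      ((∫ s in (0 : ℝ)..t, g (X s.toNNReal ω)) - t * m))) := by
    filter_upwards [hX.right_continuous] with ω hω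
    have h1 := tendsto_riemannSum_of_rightContinuous (v := fun s => g (X s ω)) (fun s => hgB _)
      (fun s => hg.continuousAt.comp_continuousWithinAt (hω s)) ht'
    have h2 := ((h1.sub_const (t * m)).const_mul θ).rexp
    have h3 := (ENNReal.continuous_ofReal.tendsto _).comp h2
    refine (h3.congr fun n => ?_).liminf_eq
    rw [hYe]; rfl
  have hYint : ∀ᶠ n in atTop, ∫⁻ ω, Y n ω ∂Pr ≤
      ENNReal.ofReal (Real.exp (t * (K + 2 * θ ^ 2 * D ^ 2 * h n))) := by
    have hev : ∀ᶠ n in atTop, 2 * θ * h n * D < 1 := by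
      have := (hh0.const_mul (2 * θ)).mul_const D
      rw [mul_zero, zero_mul] at this
      exact this.eventually_lt_const one_pos
    filter_upwards [hev] with n hn
    have e := hX.lintegral_prod_mul hP hπ (h n) (hφm n) (fun x => (Real.exp_pos _).le) (hφB n)
      (f := fun _ => 1) measurable_const (fun _ => zero_le_one) (M := 1) (fun _ => by simp) (n + 1)
    simp only [ENNReal.ofReal_one, mul_one] at e
    change ∫⁻ ω, Y n ω ∂Pr = _ at e
    rw [e]
    refine ENNReal.ofReal_le_ofReal ?_
    -- The one-step factor is 1 + 2r ≤ exp(2r), and (n + 1)h = t.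
    have := hP.integral_iterate_tilt_one_le (π := π) (h := h n) (hφm n) (hφB n)
      (r := h n * (K + 2 * θ ^ 2 * D ^ 2 * h n)) (fun f M hf hM => ?_) (n + 1)
    · rw [← mul_assoc, hnh] at this
      exact this
    · refine (hq.integral_tilt_sq_le hP hC hπ hl0 hl hgm hab.le hgab hθ0.le hn.le hf hM).trans ?_
      refine mul_le_mul_of_nonneg_right ?_ (integral_nonneg fun x => sq_nonneg _)
      refine le_trans (le_of_eq ?_) (Real.add_one_le_exp _)
      ring
  have hlimint : liminf (fun n => ∫⁻ ω, Y n ω ∂Pr) atTop ≤ ENNReal.ofReal (Real.exp (t * K)) := by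
    have h1 : Tendsto (fun n => ENNReal.ofReal (Real.exp (t * (K + 2 * θ ^ 2 * D ^ 2 * h n))))
        atTop (𝓝 (ENNReal.ofReal (Real.exp (t * K)))) := by
      have h2 := (((hh0.const_mul (2 * θ ^ 2 * D ^ 2)).const_add K).const_mul (t : ℝ)).rexp
      rw [mul_zero, add_zero] at h2
      exact (ENNReal.continuous_ofReal.tendsto _).comp h2
    rw [← h1.liminf_eq]
    exact liminf_le_liminf hYint
  set c := ENNReal.ofReal (Real.exp (θ * (t * ε))) with hc
  -- The deviation event need not be measurable; almost surely it lies in an event for the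
  -- measurable liminf, to which Markov and Fatou apply.
  have hmono : Pr {ω | ε ≤ (1 / t) * (∫ s in (0 : ℝ)..t, g (X s.toNNReal ω)) - m} ≤
      Pr {ω | c ≤ liminf (fun n => Y n ω) atTop} := by
    refine measure_mono_ae ?_
    filter_upwards [hYlim] with ω hω hω'
    change c ≤ _
    rw [hω]
    refine ENNReal.ofReal_le_ofReal (Real.exp_le_exp.2 (mul_le_mul_of_nonneg_left ?_ hθ0.le))
    have h1 : ε ≤ (1 / t) * (∫ s in (0 : ℝ)..t, g (X s.toNNReal ω)) - m := hω'
    have h2 := mul_le_mul_of_nonneg_left h1 ht.le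
    rw [mul_sub, ← mul_assoc, mul_one_div_cancel ht.ne', one_mul] at h2
    exact h2
  have hmarkov := (mul_meas_ge_le_lintegral₀ (μ := Pr)
    (Measurable.liminf hYm).aemeasurable c).trans ((lintegral_liminf_le hYm).trans hlimint)
  refine hmono.trans ?_
  have hcinv : ENNReal.ofReal (Real.exp (-(θ * (t * ε)))) * c = 1 := by
    rw [hc, ← ENNReal.ofReal_mul (Real.exp_pos _).le, ← Real.exp_add]
    simp
  calc _ = ENNReal.ofReal (Real.exp (-(θ * (t * ε)))) *
        (c * Pr {ω | c ≤ liminf (fun n => Y n ω) atTop}) := by rw [← mul_assoc, hcinv, one_mul]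
    _ ≤ ENNReal.ofReal (Real.exp (-(θ * (t * ε)))) * ENNReal.ofReal (Real.exp (t * K)) := by
        gcongr
    _ = _ := by
        rw [← ENNReal.ofReal_mul (Real.exp_pos _).le, ← Real.exp_add]
        congr 2
        rw [hK, hθ]
        field_simp
        ring

end JumpProcess

theorem mainTheorem6 {E : Type*} [TopologicalSpace E] [MeasurableSpace E] [OpensMeasurableSpace E]
    {Ω : Type*} [MeasurableSpace Ω] (Pr : Measure Ω) [IsProbabilityMeasure Pr]
    (P : ℝ≥0 → Kernel E E) (hP : JumpProcess.IsJumpTransitionFunction P)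
    (π : Measure E) [IsProbabilityMeasure π] (hπ : ∀ t, Kernel.Invariant (P t) π)
    (X : ℝ≥0 → Ω → E) (hX : JumpProcess.IsMarkovProcess Pr X P π)
    (q : E → ℝ≥0) (J : Kernel E E) (hq : JumpProcess.IsConservativeQPair P q J)
    (hbdd : JumpProcess.UniformlyBounded q)
    (hgap : 0 < JumpProcess.spectralGap P π)
    (a b : ℝ) (hab : a < b) (g : E → ℝ) (hg : Continuous g) (hgab : ∀ x, g x ∈ Set.Icc a b)
    (t ε : ℝ) (ht : 0 < t) (hε : 0 < ε) :
    Pr {ω | ε ≤ (1 / t) * (∫ s in (0 : ℝ)..t, g (X s.toNNReal ω)) - ∫ x, g x ∂π} ≤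
      EReal.exp (-(JumpProcess.spectralGap P π * ((t * ε ^ 2 / (b - a) ^ 2 : ℝ) : EReal))) := by
  obtain ⟨C, hC⟩ := hbdd
  have key : ∀ l : ℝ, 0 < l → (l : EReal) ≤ JumpProcess.spectralGap P π → _ := fun l hl0 hl =>
    hX.measure_deviation_le hP hπ hq hC hl0 hl hab hg hgab ht hε
  have hr : 0 < t * ε ^ 2 / (b - a) ^ 2 := by
    have := sub_pos.2 hab
    positivity
  generalize JumpProcess.spectralGap P π = G at *
  induction G with
  | bot => simp at hgap
  | coe l =>
    have := key l (by exact_mod_cast hgap) le_rfl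
    rwa [← EReal.coe_mul, ← EReal.coe_neg, EReal.exp_coe]
  | top =>
    -- With infinite gap every real l is admissible, and l → ∞ forces probability zero.
    rw [EReal.top_mul_coe_of_pos hr, EReal.neg_top, EReal.exp_bot]
    have hlim : Tendsto (fun l : ℝ => ENNReal.ofReal
        (Real.exp (-(l * (t * ε ^ 2 / (b - a) ^ 2))))) atTop (𝓝 0) := by
      have h1 : Tendsto (fun l : ℝ => Real.exp (-(l * (t * ε ^ 2 / (b - a) ^ 2)))) atTop (𝓝 0) :=
        Real.tendsto_exp_neg_atTop_nhds_zero.comp (tendsto_id.atTop_mul_const hr)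
      simpa [Function.comp_def] using (ENNReal.continuous_ofReal.tendsto _).comp h1
    refine ge_of_tendsto hlim ?_
    filter_upwards [eventually_gt_atTop 0] with l hl
    exact key l hl le_top
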